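/- Let $M_n=M_n(\mathbb C)$ with the Hilbert–Schmidt inner product $\langle A,B\rangle=\operatorname{tr}(A^*B)$, and let $\Phi^\dagger:M_m\to M_n$ denote the adjoint of a linear map $\Phi:M_n\to M_m$. The map $\Phi$ is unital if $\Phi(I)=I$, and completely positive if, for every $k$, applying $\Phi$ to each block takes positive semidefinite $k\times k$ block matrices to positive semidefinite block matrices. (a) For all $m,n\in\mathbb N$, all positive definite $X,Y\in M_m$, all $K\in M_m$ and all completely positive unital maps $\Phi:M_n\to M_m$, $$0\le \operatorname{tr}\left[\int_0^\infty \Phi^\dagger(K^*)\frac{1}{sI+\Phi^\dagger(Y)}\,\Phi^\dagger(K)\frac{1}{sI+\Phi^\dagger(X)}\,ds\right]\le \operatorname{tr}\left[\int_0^\infty K^*\frac{1}{sI+Y}\,K\frac{1}{sI+X}\,ds\right],$$ where both integrals converge absolutely (also when $\Phi^\dagger(X)$ or $\Phi^\dagger(Y)$ is not invertible). (b) The Bogoliubov–Kubo–Mori metric $$\gamma_\rho(K,L)=\operatorname{tr}\left[\int_0^\infty K\frac{1}{sI+\rho}\,L\frac{1}{sI+\rho}\,ds\right]$$ is a monotone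 metric. That is: for every $n$ it is a Riemannian metric (bilinear, symmetric, positive definite, and smooth in $\rho$) on the manifold $\mathfrak S_n$ of positive definite $\rho\in M_n$ with $\operatorname{tr}\rho=1$, whose tangent space at each point is the space of self-adjoint traceless matrices; and for every completely positive unital $\Phi:M_n\to M_m$ such that $\Phi^\dagger$ maps $\mathfrak S_m$ into $\mathfrak S_n$, all $\rho,\rho_1,\rho_2\in\mathfrak S_m$ and all self-adjoint traceless $K\in M_m$, $$\gamma_{\Phi^\dagger(\rho)}(\Phi^\dagger(K),\Phi^\dagger(K))\le\gamma_\rho(K,K),\qquad d(\Phi^\dagger(\rho_1),\Phi^\dagger(\rho_2))\le d(\rho_1,\rho_2),$$ where $d$ denotes the geodesic distance of $\gamma$: the infimum of the lengths of $C^1$ paths in $\mathfrak S_m$, respectively $\mathfrak S_n$. -/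

import Mathlib

-- The operator norm on matrices makes them a C⋆-algebra; its topology is the entrywise one, so
-- integrals, derivatives and smoothness below do not depend on this choice of norm.
-- `ComplexOrder`: for `z w : ℂ`, `z ≤ w` means that `w - z` is a nonnegative real number.
open scoped Matrix.Norms.L2Operator ComplexOrder ContDiff ENNReal

noncomputable section

namespace Lieb

/-- The `n × n` complex matrices. -/
abbrev Mat (n : ℕ) : Type := Matrix (Fin n) (Fin n) ℂ

/-- `Φ` is completely positive: it is `k`-positive for every `k`, i.e. applying `Φ` to each block
of a positive semidefinite `k × k` block matrix yields a positive semidefinite block matrix.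
(`Matrix.comp` reads a `k × k` matrix of blocks as a matrix of scalars.) -/
def IsCompletelyPositive {n m : ℕ} (Φ : Mat n →ₗ[ℂ] Mat m) : Prop :=
  ∀ (k : ℕ) (A : Matrix (Fin k) (Fin k) (Mat n)),
    (Matrix.comp (Fin k) (Fin k) (Fin n) (Fin n) ℂ A).PosSemidef →
      (Matrix.comp (Fin k) (Fin k) (Fin m) (Fin m) ℂ (A.map Φ)).PosSemidef

/-- `Φ` is unital. -/
def IsUnital {n m : ℕ} (Φ : Mat n →ₗ[ℂ] Mat m) : Prop := Φ 1 = 1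

/-- The adjoint `Φ†` of `Φ` for the Hilbert-Schmidt inner product `⟨A, B⟩ = tr (A* B)`: its `(i, j)`
entry at `B` is `⟨E i j, Φ† B⟩ = ⟨Φ (E i j), B⟩`, where `E i j` is the matrix unit. -/
def hsAdjoint {n m : ℕ} (Φ : Mat n →ₗ[ℂ] Mat m) : Mat m →ₗ[ℂ] Mat n where
  toFun B := Matrix.of fun i j => ((Φ (Matrix.single i j 1)).conjTranspose * B).trace
  map_add' A B := by
    ext i j
    simp [mul_add, Matrix.trace_add]
  map_smul' c B := by
    ext i j
    simp [Matrix.trace_smul]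

/-- The defining property of the Hilbert-Schmidt adjoint. -/
theorem trace_hsAdjoint {n m : ℕ} (Φ : Mat n →ₗ[ℂ] Mat m) (A : Mat n) (B : Mat m) :
    (A.conjTranspose * hsAdjoint Φ B).trace = ((Φ A).conjTranspose * B).trace := by
  have hA : Φ A = ∑ i, ∑ j, A i j • Φ (Matrix.single i j 1) := by
    conv_lhs => rw [Matrix.matrix_eq_sum_single A]
    simp only [map_sum]
    refine Finset.sum_congr rfl fun i _ => Finset.sum_congr rfl fun j _ => ?_
    rw [← map_smul, Matrix.smul_single, smul_eq_mul, mul_one]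
  rw [hA]
  simp only [Matrix.conjTranspose_sum, Matrix.conjTranspose_smul, Finset.sum_mul,
    Matrix.trace_sum, Matrix.smul_mul, Matrix.trace_smul, smul_eq_mul]
  rw [Matrix.trace, Finset.sum_comm]
  refine Finset.sum_congr rfl fun j _ => ?_
  simp [Matrix.mul_apply, hsAdjoint]

/-- The integrand `A (s I + Y)⁻¹ B (s I + X)⁻¹`. For `s > 0` and positive semidefinite `X`, `Y`
the inverses are genuine. -/
def integrand {n : ℕ} (X Y A B : Mat n) (s : ℝ) : Mat n :=
  A * ((s : ℂ) • (1 : Mat n) + Y)⁻¹ * B * ((s : ℂ) • (1 : Mat n) + X)⁻¹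

/-- `tr [∫₀^∞ A (s I + Y)⁻¹ B (s I + X)⁻¹ ds]`. -/
def traceIntegral {n : ℕ} (X Y A B : Mat n) : ℂ :=
  (∫ s in Set.Ioi (0 : ℝ), integrand X Y A B s).trace

/-- The invertible `n × n` density matrices. -/
def states (n : ℕ) : Set (Mat n) := {ρ | ρ.PosDef ∧ ρ.trace = 1}

/-- The tangent space to the invertible density matrices at each of its points: the real vector
space of traceless self-adjoint matrices. -/
def tangent (n : ℕ) : Set (Mat n) := {K | K.IsHermitian ∧ K.trace = 0}

/-- The length of a path `c : [0, 1] → states n` for a field `g` of quadratic forms. -/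
def pathLength {n : ℕ} (g : Mat n → Mat n → Mat n → ℝ) (c : ℝ → Mat n) : ℝ≥0∞ :=
  ∫⁻ t in Set.Icc (0 : ℝ) 1, ENNReal.ofReal
    (√(g (c t) (derivWithin c (Set.Icc 0 1) t) (derivWithin c (Set.Icc 0 1) t)))

/-- The geodesic distance of `ρ₁` and `ρ₂`: the infimum of the lengths of the `C¹` paths from `ρ₁`
to `ρ₂` inside the invertible density matrices. -/
def geodesicDist {n : ℕ} (g : Mat n → Mat n → Mat n → ℝ) (ρ₁ ρ₂ : Mat n) : ℝ≥0∞ :=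
  ⨅ (c : ℝ → Mat n) (_ : ContDiffOn ℝ 1 c (Set.Icc 0 1) ∧
      Set.MapsTo c (Set.Icc 0 1) (states n) ∧ c 0 = ρ₁ ∧ c 1 = ρ₂), pathLength g c

/-- `g` is a monotone metric: for every `n` it is a Riemannian metric on the invertible `n × n`
density matrices, and it contracts under every quantum operation `Φ†` that takes invertible density
matrices to invertible density matrices, both on tangent vectors and as a geodesic distance. -/
structure IsMonotoneMetric (g : ∀ n : ℕ, Mat n → Mat n → Mat n → ℝ) : Prop where
  add_left : ∀ n, ∀ ρ ∈ states n, ∀ K ∈ tangent n, ∀ K' ∈ tangent n, ∀ L ∈ tangent n,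
    g n ρ (K + K') L = g n ρ K L + g n ρ K' L
  smul_left : ∀ n, ∀ ρ ∈ states n, ∀ (a : ℝ), ∀ K ∈ tangent n, ∀ L ∈ tangent n,
    g n ρ (a • K) L = a * g n ρ K L
  symm : ∀ n, ∀ ρ ∈ states n, ∀ K ∈ tangent n, ∀ L ∈ tangent n, g n ρ K L = g n ρ L K
  pos : ∀ n, ∀ ρ ∈ states n, ∀ K ∈ tangent n, K ≠ 0 → 0 < g n ρ K K
  smooth : ∀ n, ∀ K ∈ tangent n, ∀ L ∈ tangent n,
    ContDiffOn ℝ ∞ (fun ρ => g n ρ K L) (states n)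
  contract : ∀ (n m : ℕ) (Φ : Mat n →ₗ[ℂ] Mat m), IsCompletelyPositive Φ → IsUnital Φ →
    Set.MapsTo (hsAdjoint Φ) (states m) (states n) → ∀ ρ ∈ states m, ∀ K ∈ tangent m,
      g n (hsAdjoint Φ ρ) (hsAdjoint Φ K) (hsAdjoint Φ K) ≤ g m ρ K K
  dist_contract : ∀ (n m : ℕ) (Φ : Mat n →ₗ[ℂ] Mat m), IsCompletelyPositive Φ → IsUnital Φ →
    Set.MapsTo (hsAdjoint Φ) (states m) (states n) → ∀ ρ₁ ∈ states m, ∀ ρ₂ ∈ states m,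
      geodesicDist (g n) (hsAdjoint Φ ρ₁) (hsAdjoint Φ ρ₂) ≤ geodesicDist (g m) ρ₁ ρ₂

/-- The Bogoliubov-Kubo-Mori metric
`γ_ρ(K, L) = tr [∫₀^∞ K (s I + ρ)⁻¹ L (s I + ρ)⁻¹ ds]`; the right side is real for self-adjoint
`K`, `L` and positive definite `ρ`. -/
def bkmMetric (n : ℕ) (ρ K L : Mat n) : ℝ := (traceIntegral ρ ρ K L).re

end Lieb

end

/-! Left multiplication `L_Y` and right multiplication `R_X` commute, so eigenbases of `X` and `Y`
diagonalize both. Substituting `s = t x` for each eigenvalue `x` of `X` turns the trace integral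
into `∫ (1 + t)⁻¹ ⟨K, (t R_X + L_Y)⁻¹ K⟩ dt`, with a weight free of `X` and `Y`. It suffices to
contract the form at each `t`.

That form is the maximum over `Z` of `2 Re ⟨Z, K⟩ - t tr (Z* Z X) - tr (Z Z* Y)`. Under `Φ†` the
linear term becomes `⟨Φ Z, K⟩`, and the Schwarz inequality `Φ(Z) Φ(Z)* ≤ Φ(Z Z*)` controls the
quadratic terms. So the optimal `Z` for the image data gives a trial matrix `Φ Z` for the original
data (`resolventForm_hsAdjoint_le`).

If `Φ† X` or `Φ† Y` is singular, the same estimates show that `Φ† K` has no coordinates at zero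
eigenvalues (`supports_hsAdjoint`), so the integral still converges.

For smoothness, `u = (1 + s)⁻¹` gives `(s + ρ)⁻¹ = u ((1 - u) + u ρ)⁻¹`: an inverse in the Banach
algebra `C([0, 1], M_n)`, followed by a bounded linear map. Distances contract because the linear
map `Φ†` carries paths to paths of no greater speed. -/

noncomputable section

namespace Lieb

open Matrix MeasureTheory Set

variable {n m : ℕ}

/-! ### Coordinates in a pair of eigenbases. -/

/-- A unitary diagonalization of a matrix with real eigenvalues. -/
structure Diagonalization (X : Mat n) where
  basis : Mat n
  eigenvalue : Fin n → ℝ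
  conjTranspose_mul_basis : basisᴴ * basis = 1
  eq : X = basis * diagonal (fun i => (eigenvalue i : ℂ)) * basisᴴ

namespace Diagonalization

theorem basis_mul_conjTranspose {X : Mat n} (d : Diagonalization X) : d.basis * d.basisᴴ = 1 :=
  mul_eq_one_comm.mp d.conjTranspose_mul_basis

def ofIsHermitian {X : Mat n} (h : X.IsHermitian) : Diagonalization X where
  basis := h.eigenvectorUnitary
  eigenvalue := h.eigenvalues
  conjTranspose_mul_basis := by
    simpa [star_eq_conjTranspose] using Unitary.coe_star_mul_self h.eigenvectorUnitary
  eq := by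
    conv_lhs => rw [h.spectral_theorem, Unitary.conjStarAlgAut_apply]
    rfl

variable {X Y : Mat n} (dX : Diagonalization X) (dY : Diagonalization Y)

/-- The matrix of `B` with respect to eigenbases of `X` (source) and `Y` (target). -/
def coord (B : Mat n) : Mat n := dY.basisᴴ * B * dX.basis

/-- The matrix with given coordinates with respect to eigenbases of `X` and `Y`. -/
def ofCoord (k : Mat n) : Mat n := dY.basis * k * dX.basisᴴ

theorem coord_ofCoord (k : Mat n) : coord dX dY (ofCoord dX dY k) = k := by
  have h₁ := dX.conjTranspose_mul_basis
  have h₂ := dY.conjTranspose_mul_basis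
  calc _ = (dY.basisᴴ * dY.basis) * k * (dX.basisᴴ * dX.basis) := by
        simp only [coord, ofCoord, Matrix.mul_assoc]
    _ = k := by simp [h₁, h₂]

theorem ofCoord_coord (B : Mat n) : ofCoord dX dY (coord dX dY B) = B := by
  have h₁ := dX.basis_mul_conjTranspose
  have h₂ := dY.basis_mul_conjTranspose
  calc _ = (dY.basis * dY.basisᴴ) * B * (dX.basis * dX.basisᴴ) := by
        simp only [coord, ofCoord, Matrix.mul_assoc]
    _ = B := by simp [h₁, h₂]

theorem coord_add (A B : Mat n) : coord dX dY (A + B) = coord dX dY A + coord dX dY B := by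
  simp [coord, mul_add, add_mul]

theorem coord_smul (a : ℝ) (B : Mat n) : coord dX dY (a • B) = a • coord dX dY B := by
  simp [coord]

theorem coord_eq_zero_iff {B : Mat n} : coord dX dY B = 0 ↔ B = 0 := by
  constructor
  · intro h
    rw [← ofCoord_coord dX dY B, h]
    simp [ofCoord]
  · rintro rfl
    simp [coord]

theorem conjTranspose_coord (B : Mat n) : (coord dX dY B)ᴴ = coord dY dX Bᴴ := by
  simp [coord, Matrix.mul_assoc]

/-- Both bases are unitary, so passing to coordinates is a Hilbert–Schmidt isometry. -/
theorem trace_conjTranspose_mul (A B : Mat n) :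
    (Aᴴ * B).trace = ∑ j, ∑ i, star (coord dX dY A j i) * coord dX dY B j i := by
  have h : (Aᴴ * B).trace = ((coord dX dY A)ᴴ * coord dX dY B).trace := by
    have h₂ := dY.basis_mul_conjTranspose
    calc (Aᴴ * B).trace = (Aᴴ * (dY.basis * dY.basisᴴ) * B * (dX.basis * dX.basisᴴ)).trace := by
          simp [h₂, dX.basis_mul_conjTranspose]
      _ = (dX.basisᴴ * (Aᴴ * (dY.basis * dY.basisᴴ) * B * dX.basis)).trace := by
          rw [trace_mul_comm dX.basisᴴ]; simp only [Matrix.mul_assoc]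
      _ = _ := by
          simp only [coord, conjTranspose_mul, conjTranspose_conjTranspose, Matrix.mul_assoc]
  rw [h, trace, Finset.sum_comm]
  simp [Matrix.mul_apply]

theorem coord_mul_right (Z : Mat n) (j i : Fin n) :
    coord dX dY (Z * X) j i = coord dX dY Z j i * dX.eigenvalue i := by
  have : coord dX dY (Z * X) = coord dX dY Z * diagonal (fun i => (dX.eigenvalue i : ℂ)) := by
    have h : Z * X = Z * (dX.basis * diagonal (fun i => (dX.eigenvalue i : ℂ)) * dX.basisᴴ) :=
      congrArg (Z * ·) dX.eq
    calc _ = dY.basisᴴ * Z * dX.basis * diagonal (fun i => (dX.eigenvalue i : ℂ)) *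
          (dX.basisᴴ * dX.basis) := by simp only [coord, h, Matrix.mul_assoc]
      _ = _ := by rw [dX.conjTranspose_mul_basis, mul_one, coord]
  rw [this, mul_diagonal]

theorem coord_mul_left (Z : Mat n) (j i : Fin n) :
    coord dX dY (Y * Z) j i = dY.eigenvalue j * coord dX dY Z j i := by
  have : coord dX dY (Y * Z) = diagonal (fun i => (dY.eigenvalue i : ℂ)) * coord dX dY Z := by
    have h : Y * Z = dY.basis * diagonal (fun i => (dY.eigenvalue i : ℂ)) * dY.basisᴴ * Z :=
      congrArg (· * Z) dY.eq
    calc _ = (dY.basisᴴ * dY.basis) * diagonal (fun i => (dY.eigenvalue i : ℂ)) *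
          (dY.basisᴴ * Z * dX.basis) := by simp only [coord, h, Matrix.mul_assoc]
      _ = _ := by rw [dY.conjTranspose_mul_basis, one_mul, coord]
  rw [this, diagonal_mul]

theorem trace_conjTranspose_mul_self_mul (Z : Mat n) :
    (Zᴴ * Z * X).trace =
      ((∑ j, ∑ i, dX.eigenvalue i * ‖coord dX dY Z j i‖ ^ 2 : ℝ) : ℂ) := by
  rw [Matrix.mul_assoc, trace_conjTranspose_mul dX dY]
  push_cast
  refine Finset.sum_congr rfl fun j _ => Finset.sum_congr rfl fun i _ => ?_
  rw [coord_mul_right, ← mul_assoc, Complex.star_def, Complex.conj_mul', mul_comm]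

theorem trace_self_mul_conjTranspose_mul (Z : Mat n) :
    (Z * Zᴴ * Y).trace =
      ((∑ j, ∑ i, dY.eigenvalue j * ‖coord dX dY Z j i‖ ^ 2 : ℝ) : ℂ) := by
  rw [Matrix.mul_assoc, trace_mul_comm, Matrix.mul_assoc,
    trace_conjTranspose_mul dX dY]
  push_cast
  refine Finset.sum_congr rfl fun j _ => Finset.sum_congr rfl fun i _ => ?_
  rw [coord_mul_left, mul_left_comm, Complex.star_def, Complex.conj_mul']

end Diagonalization

open Diagonalization

/-! ### Variational formula for the resolvent form. -/

/-- A concave functional in `Z` whose maximum is `∑ |kⱼᵢ|² / (t xᵢ + yⱼ)`. -/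
def dualFunctional (t : ℝ) (X Y B Z : Mat n) : ℝ :=
  2 * (Zᴴ * B).trace.re - t * (Zᴴ * Z * X).trace.re - (Z * Zᴴ * Y).trace.re

/-- `⟨B, (t R_X + L_Y)⁻¹ B⟩`, for the left and right multiplications `L_Y` and `R_X`. -/
def resolventForm {X Y : Mat n} (dX : Diagonalization X) (dY : Diagonalization Y) (B : Mat n)
    (t : ℝ) : ℝ :=
  ∑ j, ∑ i, ‖coord dX dY B j i‖ ^ 2 / (t * dX.eigenvalue i + dY.eigenvalue j)

theorem dualFunctional_eq {X Y : Mat n} (dX : Diagonalization X) (dY : Diagonalization Y)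
    (B Z : Mat n) (t : ℝ) : dualFunctional t X Y B Z =
      ∑ j, ∑ i, (2 * (star (coord dX dY Z j i) * coord dX dY B j i).re -
        (t * dX.eigenvalue i + dY.eigenvalue j) * ‖coord dX dY Z j i‖ ^ 2) := by
  rw [dualFunctional, trace_conjTranspose_mul_self_mul dX dY,
    trace_self_mul_conjTranspose_mul dX dY, trace_conjTranspose_mul dX dY]
  simp only [Complex.ofReal_re, Complex.re_sum, Finset.mul_sum, ← Finset.sum_sub_distrib]
  refine Finset.sum_congr rfl fun j _ => Finset.sum_congr rfl fun i _ => ?_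
  ring

theorem dualFunctional_le {X Y : Mat n} (dX : Diagonalization X) (dY : Diagonalization Y)
    (B Z : Mat n) {t : ℝ} (h : ∀ i j, 0 < t * dX.eigenvalue i + dY.eigenvalue j) :
    dualFunctional t X Y B Z ≤ resolventForm dX dY B t := by
  rw [dualFunctional_eq dX dY, resolventForm]
  refine Finset.sum_le_sum fun j _ => Finset.sum_le_sum fun i _ => ?_
  have h₁ := (Complex.re_le_norm (star (coord dX dY Z j i) * coord dX dY B j i))
  rw [norm_mul, norm_star] at h₁
  rw [le_div_iff₀ (h i j)]
  -- With `a` the denominator, `z = ‖Zⱼᵢ‖` and `k = ‖Bⱼᵢ‖`, this is `(a z - k)² ≥ 0`.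
  nlinarith [h i j, sq_nonneg ((t * dX.eigenvalue i + dY.eigenvalue j) * ‖coord dX dY Z j i‖ -
    ‖coord dX dY B j i‖), mul_le_mul_of_nonneg_left h₁ (h i j).le]

/-- The critical point is `Zⱼᵢ = Bⱼᵢ / (t xᵢ + yⱼ)`. No positivity is needed: at a zero denominator,
division by zero makes both terms `0`. Hence this also applies to singular image data. -/
theorem exists_dualFunctional_eq {X Y : Mat n} (dX : Diagonalization X) (dY : Diagonalization Y)
    (B : Mat n) (t : ℝ) :
    ∃ Z, dualFunctional t X Y B Z = resolventForm dX dY B t := by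
  refine ⟨ofCoord dX dY (Matrix.of fun j i =>
    ((t * dX.eigenvalue i + dY.eigenvalue j)⁻¹ : ℝ) * coord dX dY B j i), ?_⟩
  rw [dualFunctional_eq dX dY, resolventForm, coord_ofCoord]
  refine Finset.sum_congr rfl fun j _ => Finset.sum_congr rfl fun i _ => ?_
  by_cases h₀ : t * dX.eigenvalue i + dY.eigenvalue j = 0
  · simp [h₀]
  · have h₂ : (star (coord dX dY B j i) * coord dX dY B j i).re = ‖coord dX dY B j i‖ ^ 2 := by
      rw [Complex.star_def, Complex.conj_mul']
      norm_cast
    rw [of_apply, star_mul', mul_assoc, Complex.star_def, Complex.conj_ofReal,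
      Complex.re_ofReal_mul, ← Complex.star_def, h₂, norm_mul, Complex.norm_real, mul_pow,
      Real.norm_eq_abs, sq_abs]
    field_simp
    ring

/-! ### Scalar integrals. -/

theorem integrableOn_inv_mul_add {x y : ℝ} (hx : 0 < x) (hy : 0 < y) :
    IntegrableOn (fun s => ((s + y) * (s + x))⁻¹) (Ioi 0) := by
  have h : IntegrableOn (fun s : ℝ => (s + min x y) ^ (-2 : ℝ)) (Ioi 0) :=
    integrableOn_add_rpow_Ioi_of_lt (by norm_num) (by simp [hx, hy])
  refine Integrable.mono' h ?_ ?_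
  · exact (Measurable.inv (by fun_prop)).aestronglyMeasurable
  · refine (ae_restrict_iff' measurableSet_Ioi).mpr (.of_forall fun s (hs : 0 < s) => ?_)
    have hm : 0 < min x y := lt_min hx hy
    rw [Real.norm_of_nonneg (by positivity), Real.rpow_neg (by positivity), Real.rpow_two, sq]
    gcongr
    · exact min_le_right x y
    · exact min_le_left x y

/-- The scalar integral `∫₀^∞ ds / ((s + y) (s + x))`. -/
def resolventIntegral (x y : ℝ) : ℝ := ∫ s in Ioi (0 : ℝ), ((s + y) * (s + x))⁻¹

theorem resolventIntegral_comm (x y : ℝ) : resolventIntegral x y = resolventIntegral y x := by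
  simp [resolventIntegral, mul_comm]

theorem resolventIntegral_pos {x y : ℝ} (hx : 0 < x) (hy : 0 < y) :
    0 < resolventIntegral x y := by
  rw [resolventIntegral, setIntegral_pos_iff_support_of_nonneg_ae _
    (integrableOn_inv_mul_add hx hy)]
  · refine lt_of_lt_of_le ?_ (measure_mono (s := Ioi (0 : ℝ)) fun s (hs : 0 < s) => ?_)
    · simp
    · refine ⟨?_, hs⟩
      rw [Function.mem_support]
      positivity
  · refine (ae_restrict_iff' measurableSet_Ioi).mpr (.of_forall fun s (hs : 0 < s) => ?_)
    simp only [Pi.zero_apply]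
    positivity

/-- The substitution `s = x t`; the factor `x` on the right is the Jacobian. -/
theorem scaled_inv_mul_add {x y : ℝ} (hx : 0 < x) (t : ℝ) :
    (1 + t)⁻¹ * (t * x + y)⁻¹ = x * ((x * t + y) * (x * t + x))⁻¹ := by
  rw [show x * t + x = x * (1 + t) by ring, mul_inv, mul_inv, mul_comm t x]
  field_simp

theorem integrableOn_scaled {x y : ℝ} (hx : 0 < x) (hy : 0 < y) :
    IntegrableOn (fun t => (1 + t)⁻¹ * (t * x + y)⁻¹) (Ioi 0) := by
  simp only [scaled_inv_mul_add hx]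
  refine Integrable.const_mul ?_ _
  have := (integrableOn_Ioi_comp_mul_left_iff (fun s => ((s + y) * (s + x))⁻¹) 0 hx).mpr
  exact this (by simpa only [mul_zero] using integrableOn_inv_mul_add hx hy)

theorem integral_scaled {x y : ℝ} (hx : 0 < x) :
    ∫ t in Ioi (0 : ℝ), (1 + t)⁻¹ * (t * x + y)⁻¹ = resolventIntegral x y := by
  simp only [scaled_inv_mul_add hx]
  rw [integral_const_mul,
    integral_comp_mul_left_Ioi (fun s => ((s + y) * (s + x))⁻¹) 0 hx, mul_zero, smul_eq_mul,
    mul_inv_cancel_left₀ hx.ne', resolventIntegral]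

/-! ### The trace integral in eigenbases. -/

namespace Diagonalization

variable {X Y : Mat n} (dX : Diagonalization X) (dY : Diagonalization Y)

theorem inv_smul_one_add {s : ℝ} (h : ∀ i, s + dX.eigenvalue i ≠ 0) :
    ((s : ℂ) • (1 : Mat n) + X)⁻¹ =
      dX.basis * diagonal (fun i => (((s + dX.eigenvalue i)⁻¹ : ℝ) : ℂ)) * dX.basisᴴ := by
  have hX : (s : ℂ) • (1 : Mat n) + X =
      dX.basis * diagonal (fun i => ((s + dX.eigenvalue i : ℝ) : ℂ)) * dX.basisᴴ := by
    have hd : diagonal (fun i => ((s + dX.eigenvalue i : ℝ) : ℂ)) =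
        (s : ℂ) • (1 : Mat n) + diagonal (fun i => (dX.eigenvalue i : ℂ)) := by
      rw [smul_one_eq_diagonal, diagonal_add]
      simp
    rw [hd, mul_add, add_mul, ← dX.eq]
    simp [dX.basis_mul_conjTranspose]
  refine inv_eq_right_inv ?_
  rw [hX]
  calc _ = dX.basis * diagonal (fun i => ((s + dX.eigenvalue i : ℝ) : ℂ)) *
        (dX.basisᴴ * dX.basis) * diagonal (fun i => (((s + dX.eigenvalue i)⁻¹ : ℝ) : ℂ)) *
        dX.basisᴴ := by simp only [Matrix.mul_assoc]
    _ = 1 := by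
      rw [dX.conjTranspose_mul_basis, mul_one, Matrix.mul_assoc dX.basis, diagonal_mul_diagonal]
      simp only [← Complex.ofReal_mul, mul_inv_cancel₀ (h _), Complex.ofReal_one]
      rw [diagonal_one, mul_one, dX.basis_mul_conjTranspose]

/-- The coefficient of `((s + yⱼ) (s + xᵢ))⁻¹` in `integrand X Y A B s`. -/
def coefficient (A B : Mat n) (j i : Fin n) : Mat n :=
  A * ofCoord dX dY (Matrix.single j i (coord dX dY B j i))

theorem integrand_eq (A B : Mat n) {s : ℝ} (hX : ∀ i, s + dX.eigenvalue i ≠ 0)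
    (hY : ∀ j, s + dY.eigenvalue j ≠ 0) :
    integrand X Y A B s = ∑ j, ∑ i,
      ((s + dY.eigenvalue j) * (s + dX.eigenvalue i))⁻¹ • coefficient dX dY A B j i := by
  rw [integrand, dX.inv_smul_one_add hX, dY.inv_smul_one_add hY]
  -- In coordinates both resolvents are diagonal, so they multiply the `(j, i)` entry by a scalar.
  have hk : diagonal (fun i => (((s + dY.eigenvalue i)⁻¹ : ℝ) : ℂ)) * coord dX dY B *
      diagonal (fun i => (((s + dX.eigenvalue i)⁻¹ : ℝ) : ℂ)) = ∑ j, ∑ i,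
      ((s + dY.eigenvalue j) * (s + dX.eigenvalue i))⁻¹ •
        Matrix.single j i (coord dX dY B j i) := by
    rw [matrix_eq_sum_single (_ * _ * _)]
    refine Finset.sum_congr rfl fun j _ => Finset.sum_congr rfl fun i _ => ?_
    rw [mul_diagonal, diagonal_mul, smul_single, Complex.real_smul]
    congr 1
    push_cast
    rw [mul_inv]
    ring
  calc _ = A * (dY.basis * (diagonal (fun i => (((s + dY.eigenvalue i)⁻¹ : ℝ) : ℂ)) *
        coord dX dY B * diagonal (fun i => (((s + dX.eigenvalue i)⁻¹ : ℝ) : ℂ))) * dX.basisᴴ) := by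
        simp only [coord, Matrix.mul_assoc]
    _ = _ := by
      rw [hk]
      simp only [coefficient, ofCoord, Matrix.mul_sum, Matrix.sum_mul, Matrix.mul_smul,
        Matrix.smul_mul]

theorem trace_coefficient (A B : Mat n) (j i : Fin n) :
    (coefficient dX dY A B j i).trace = coord dY dX A i j * coord dX dY B j i := by
  have h := trace_conjTranspose_mul dX dY Aᴴ
    (ofCoord dX dY (Matrix.single j i (coord dX dY B j i)))
  rw [conjTranspose_conjTranspose, coord_ofCoord] at h
  rw [coefficient, h, Finset.sum_eq_single j _ (by simp), Finset.sum_eq_single i _ (by simp),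
    single_apply_same, ← conjTranspose_apply, conjTranspose_coord, conjTranspose_conjTranspose]
  · intro i' _ hi
    simp [hi.symm]
  · intro j' _ hj
    simp [hj.symm]

/-- `B` vanishes on the kernel of `X` and has range orthogonal to the kernel of `Y`. -/
def Supports (B : Mat n) : Prop :=
  ∀ j i, coord dX dY B j i ≠ 0 → 0 < dX.eigenvalue i ∧ 0 < dY.eigenvalue j

variable {dX dY}

theorem integrableOn_term {B : Mat n} (hB : Supports dX dY B) (A : Mat n) (j i : Fin n) :
    IntegrableOn (fun s : ℝ =>
      ((s + dY.eigenvalue j) * (s + dX.eigenvalue i))⁻¹ • coefficient dX dY A B j i) (Ioi 0) := by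
  -- A nonpositive eigenvalue only meets a zero coefficient.
  by_cases h : coord dX dY B j i = 0
  · simp [coefficient, h, ofCoord]
  · exact (integrableOn_inv_mul_add (hB j i h).1 (hB j i h).2).smul_const _

theorem integrand_eqOn (hX : ∀ i, 0 ≤ dX.eigenvalue i) (hY : ∀ j, 0 ≤ dY.eigenvalue j)
    (A B : Mat n) : EqOn (integrand X Y A B) (fun s => ∑ j, ∑ i,
      ((s + dY.eigenvalue j) * (s + dX.eigenvalue i))⁻¹ • coefficient dX dY A B j i) (Ioi 0) :=
  fun s (hs : 0 < s) => integrand_eq dX dY A B (fun i => (add_pos_of_pos_of_nonneg hs (hX i)).ne')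
    (fun j => (add_pos_of_pos_of_nonneg hs (hY j)).ne')

theorem integrableOn_integrand (hX : ∀ i, 0 ≤ dX.eigenvalue i) (hY : ∀ j, 0 ≤ dY.eigenvalue j)
    {B : Mat n} (hB : Supports dX dY B) (A : Mat n) :
    IntegrableOn (integrand X Y A B) (Ioi 0) := by
  rw [integrableOn_congr_fun (integrand_eqOn hX hY A B) measurableSet_Ioi]
  exact integrable_finsetSum _ fun j _ => integrable_finsetSum _ fun i _ =>
    integrableOn_term hB A j i

theorem traceIntegral_eq (hX : ∀ i, 0 ≤ dX.eigenvalue i) (hY : ∀ j, 0 ≤ dY.eigenvalue j)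
    {B : Mat n} (hB : Supports dX dY B) (A : Mat n) :
    traceIntegral X Y A B = ∑ j, ∑ i, resolventIntegral (dX.eigenvalue i) (dY.eigenvalue j) *
      (coord dY dX A i j * coord dX dY B j i) := by
  rw [traceIntegral, setIntegral_congr_fun measurableSet_Ioi (integrand_eqOn hX hY A B),
    integral_finsetSum _ fun j _ => integrable_finsetSum _ fun i _ => integrableOn_term hB A j i,
    trace_sum]
  refine Finset.sum_congr rfl fun j _ => ?_
  rw [integral_finsetSum _ fun i _ => integrableOn_term hB A j i, trace_sum]
  refine Finset.sum_congr rfl fun i _ => ?_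
  rw [integral_smul_const, trace_smul, trace_coefficient, Complex.real_smul, resolventIntegral]

theorem traceIntegral_conjTranspose_eq (hX : ∀ i, 0 ≤ dX.eigenvalue i)
    (hY : ∀ j, 0 ≤ dY.eigenvalue j) {B : Mat n} (hB : Supports dX dY B) :
    traceIntegral X Y Bᴴ B = ((∑ j, ∑ i, resolventIntegral (dX.eigenvalue i) (dY.eigenvalue j) *
      ‖coord dX dY B j i‖ ^ 2 : ℝ) : ℂ) := by
  rw [traceIntegral_eq hX hY hB]
  push_cast
  refine Finset.sum_congr rfl fun j _ => Finset.sum_congr rfl fun i _ => ?_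
  rw [← conjTranspose_coord, conjTranspose_apply, Complex.star_def, Complex.conj_mul']

theorem integrableOn_resolventForm_term {B : Mat n} (hB : Supports dX dY B) (j i : Fin n) :
    IntegrableOn (fun t : ℝ => (1 + t)⁻¹ * (‖coord dX dY B j i‖ ^ 2 /
      (t * dX.eigenvalue i + dY.eigenvalue j))) (Ioi 0) := by
  by_cases h : coord dX dY B j i = 0
  · simp [h]
  · have := (integrableOn_scaled (hB j i h).1 (hB j i h).2).mul_const (‖coord dX dY B j i‖ ^ 2)
    refine IntegrableOn.congr_fun this (fun t _ => ?_) measurableSet_Ioi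
    simp only [div_eq_mul_inv]
    ring

theorem integrableOn_resolventForm {B : Mat n} (hB : Supports dX dY B) :
    IntegrableOn (fun t : ℝ => (1 + t)⁻¹ * resolventForm dX dY B t) (Ioi 0) := by
  simp only [resolventForm, Finset.mul_sum]
  exact integrable_finsetSum _ fun j _ => integrable_finsetSum _ fun i _ =>
    integrableOn_resolventForm_term hB j i

theorem integral_resolventForm {B : Mat n} (hB : Supports dX dY B) :
    ∫ t in Ioi (0 : ℝ), (1 + t)⁻¹ * resolventForm dX dY B t =
      ∑ j, ∑ i, resolventIntegral (dX.eigenvalue i) (dY.eigenvalue j) *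
        ‖coord dX dY B j i‖ ^ 2 := by
  simp only [resolventForm, Finset.mul_sum]
  rw [integral_finsetSum _ fun j _ => integrable_finsetSum _ fun i _ =>
    integrableOn_resolventForm_term hB j i]
  refine Finset.sum_congr rfl fun j _ => ?_
  rw [integral_finsetSum _ fun i _ => integrableOn_resolventForm_term hB j i]
  refine Finset.sum_congr rfl fun i _ => ?_
  by_cases h : coord dX dY B j i = 0
  · simp [h]
  · rw [← integral_scaled (hB j i h).1, ← integral_mul_const]
    refine integral_congr_ae (.of_forall fun t => ?_)
    simp only [div_eq_mul_inv]
    ring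

/-- Reduces monotonicity of the trace integral to monotonicity of the resolvent form at each `t`. -/
theorem traceIntegral_eq_integral_resolventForm (hX : ∀ i, 0 ≤ dX.eigenvalue i)
    (hY : ∀ j, 0 ≤ dY.eigenvalue j) {B : Mat n} (hB : Supports dX dY B) :
    traceIntegral X Y Bᴴ B =
      ((∫ t in Ioi (0 : ℝ), (1 + t)⁻¹ * resolventForm dX dY B t : ℝ) : ℂ) := by
  rw [traceIntegral_conjTranspose_eq hX hY hB, integral_resolventForm hB]

end Diagonalization

/-! ### The Schwarz inequality from 2-positivity. -/

/-- The block column `(Z, 1)ᵀ`, as a matrix of scalars. -/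
def blockColumn (Z : Mat n) : Matrix (Fin 2 × Fin n) (Fin n) ℂ :=
  Matrix.of fun p => (![Z, 1] : Fin 2 → Mat n) p.1 p.2

/-- The block matrix `[[Z Z*, Z], [Z*, 1]]`. -/
def schwarzBlock (Z : Mat n) : Matrix (Fin 2) (Fin 2) (Mat n) :=
  Matrix.of ![![Z * Zᴴ, Z], ![Zᴴ, 1]]

theorem posSemidef_comp_schwarzBlock (Z : Mat n) :
    (comp (Fin 2) (Fin 2) (Fin n) (Fin n) ℂ (schwarzBlock Z)).PosSemidef := by
  have : comp (Fin 2) (Fin 2) (Fin n) (Fin n) ℂ (schwarzBlock Z) =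
      blockColumn Z * (blockColumn Z)ᴴ := by
    ext ⟨a, i⟩ ⟨b, j⟩
    fin_cases a <;> fin_cases b <;>
      simp [schwarzBlock, blockColumn, Matrix.mul_apply, Matrix.one_apply]
  rw [this]
  exact posSemidef_self_mul_conjTranspose _

/-- The block column `(1, -W)ᵀ`, as a matrix of scalars. -/
def schurColumn (W : Mat n) : Matrix (Fin 2 × Fin n) (Fin n) ℂ :=
  Matrix.of fun p => (![1, -W] : Fin 2 → Mat n) p.1 p.2

variable {Φ : Mat n →ₗ[ℂ] Mat m}

/-- The image of the positive block is Hermitian; compare its off-diagonal blocks. -/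
theorem IsCompletelyPositive.map_conjTranspose (hΦ : IsCompletelyPositive Φ) (Z : Mat n) :
    Φ Zᴴ = (Φ Z)ᴴ := by
  have h := (hΦ 2 _ (posSemidef_comp_schwarzBlock Z)).isHermitian
  ext i j
  simpa [schwarzBlock] using (h.apply (1, i) (0, j)).symm

/-- The Schwarz inequality. -/
theorem IsCompletelyPositive.posSemidef_schwarz (hΦ : IsCompletelyPositive Φ) (h₁ : IsUnital Φ)
    (Z : Mat n) : (Φ (Z * Zᴴ) - Φ Z * (Φ Z)ᴴ).PosSemidef := by
  -- Compressing the image block by `(1, -Φ(Z)*)ᵀ` leaves its Schur complement.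
  have h := (hΦ 2 _ (posSemidef_comp_schwarzBlock Z)).conjTranspose_mul_mul_same
    (schurColumn (Φ Z)ᴴ)
  convert h using 1
  have h₁ : Φ 1 = 1 := h₁
  ext i j
  simp [schwarzBlock, schurColumn, Matrix.mul_apply, Fintype.sum_prod_type, Matrix.one_apply, h₁,
    hΦ.map_conjTranspose, Finset.sum_add_distrib, add_mul, sub_eq_add_neg]

open scoped MatrixOrder in
theorem _root_.Matrix.PosSemidef.trace_mul_nonneg {A B : Mat n} (hA : A.PosSemidef)
    (hB : B.PosSemidef) : 0 ≤ (A * B).trace := by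
  obtain ⟨C, rfl⟩ := CStarAlgebra.nonneg_iff_eq_star_mul_self.mp hB.nonneg
  rw [star_eq_conjTranspose] at *
  rw [← Matrix.mul_assoc, trace_mul_comm, ← Matrix.mul_assoc]
  exact (hA.mul_mul_conjTranspose_same C).trace_nonneg

/-! ### Duality between `Φ` and `Φ†`. -/

theorem IsCompletelyPositive.hsAdjoint_conjTranspose (hΦ : IsCompletelyPositive Φ) (K : Mat m) :
    hsAdjoint Φ Kᴴ = (hsAdjoint Φ K)ᴴ := by
  ext i j
  simp only [hsAdjoint, LinearMap.coe_mk, AddHom.coe_mk, of_apply, conjTranspose_apply]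
  rw [← trace_conjTranspose, conjTranspose_mul, conjTranspose_conjTranspose,
    ← hΦ.map_conjTranspose, conjTranspose_single, star_one, trace_mul_comm]

/-- Pair the Schwarz inequality with `Y` and move `Φ` across the trace. -/
theorem IsCompletelyPositive.trace_mul_conjTranspose_le (hΦ : IsCompletelyPositive Φ)
    (h₁ : IsUnital Φ) {Y : Mat m} (hY : Y.PosSemidef)
    (Z : Mat n) :
    (Φ Z * (Φ Z)ᴴ * Y).trace.re ≤ (Z * Zᴴ * hsAdjoint Φ Y).trace.re := by
  have h := (hΦ.posSemidef_schwarz h₁ Z).trace_mul_nonneg hY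
  have h' : (Z * Zᴴ * hsAdjoint Φ Y).trace = (Φ (Z * Zᴴ) * Y).trace := by
    have := trace_hsAdjoint Φ (Z * Zᴴ) Y
    rwa [← hΦ.map_conjTranspose, conjTranspose_mul, conjTranspose_conjTranspose] at this
  rw [h']
  rw [sub_mul, trace_sub] at h
  simpa using (Complex.le_def.mp h).1

theorem IsCompletelyPositive.trace_conjTranspose_mul_le (hΦ : IsCompletelyPositive Φ)
    (h₁ : IsUnital Φ) {X : Mat m} (hX : X.PosSemidef)
    (Z : Mat n) :
    ((Φ Z)ᴴ * Φ Z * X).trace.re ≤ (Zᴴ * Z * hsAdjoint Φ X).trace.re := by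
  simpa [hΦ.map_conjTranspose] using hΦ.trace_mul_conjTranspose_le h₁ hX Zᴴ

/-- The linear terms agree by adjointness; the subtracted quadratic terms only shrink, by Schwarz.
-/
theorem IsCompletelyPositive.dualFunctional_le_dualFunctional (hΦ : IsCompletelyPositive Φ)
    (h₁ : IsUnital Φ) {X Y : Mat m} (hX : X.PosSemidef)
    (hY : Y.PosSemidef) (K : Mat m) (Z : Mat n) {t : ℝ} (ht : 0 ≤ t) :
    dualFunctional t (hsAdjoint Φ X) (hsAdjoint Φ Y) (hsAdjoint Φ K) Z ≤
      dualFunctional t X Y K (Φ Z) := by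
  have h₂ := mul_le_mul_of_nonneg_left (hΦ.trace_conjTranspose_mul_le h₁ hX Z) ht
  have h₃ := hΦ.trace_mul_conjTranspose_le h₁ hY Z
  rw [dualFunctional, dualFunctional, trace_hsAdjoint]
  linarith

/-! ### Supports and contraction of the resolvent form. -/

namespace Diagonalization

variable {X Y : Mat n} (dX : Diagonalization X) (dY : Diagonalization Y)

/-- The rank one matrix `vⱼ uᵢ*` for eigenvectors `uᵢ` of `X` and `vⱼ` of `Y`. -/
def transition (j i : Fin n) : Mat n := ofCoord dX dY (Matrix.single j i 1)

theorem sum_mul_norm_coord_transition (f : Fin n → Fin n → ℝ) (j i : Fin n) :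
    ∑ j', ∑ i', f j' i' * ‖coord dX dY (transition dX dY j i) j' i'‖ ^ 2 = f j i := by
  rw [transition, coord_ofCoord, Finset.sum_eq_single j _ (by simp),
    Finset.sum_eq_single i _ (by simp)]
  · simp
  · intro i' _ hi
    simp [hi.symm]
  · intro j' _ hj
    simp [hj.symm]

theorem trace_transition_source (j i : Fin n) :
    ((transition dX dY j i)ᴴ * transition dX dY j i * X).trace.re = dX.eigenvalue i := by
  rw [trace_conjTranspose_mul_self_mul dX dY, Complex.ofReal_re,
    sum_mul_norm_coord_transition dX dY (fun _ i => dX.eigenvalue i)]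

theorem trace_transition_target (j i : Fin n) :
    (transition dX dY j i * (transition dX dY j i)ᴴ * Y).trace.re = dY.eigenvalue j := by
  rw [trace_self_mul_conjTranspose_mul dX dY, Complex.ofReal_re,
    sum_mul_norm_coord_transition dX dY (fun j _ => dY.eigenvalue j)]

theorem trace_conjTranspose_transition_mul (B : Mat n) (j i : Fin n) :
    ((transition dX dY j i)ᴴ * B).trace = coord dX dY B j i := by
  rw [trace_conjTranspose_mul dX dY, transition, coord_ofCoord,
    Finset.sum_eq_single j _ (by simp), Finset.sum_eq_single i _ (by simp)]
  · simp
  · intro i' _ hi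
    simp [hi.symm]
  · intro j' _ hj
    simp [hj.symm]

theorem eigenvalue_ofIsHermitian_pos (hX : X.PosDef) (i : Fin n) :
    0 < (ofIsHermitian hX.isHermitian).eigenvalue i :=
  hX.eigenvalues_pos i

variable {dX dY}

theorem supports_of_pos (hX : ∀ i, 0 < dX.eigenvalue i) (hY : ∀ j, 0 < dY.eigenvalue j)
    (B : Mat n) : Supports dX dY B :=
  fun j i _ => ⟨hX i, hY j⟩

theorem _root_.Lieb.eq_zero_of_trace_mul_nonpos {X W : Mat m} (hX : X.PosDef)
    (h : (Wᴴ * W * X).trace.re ≤ 0) : W = 0 := by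
  set d := ofIsHermitian hX.isHermitian
  rw [trace_conjTranspose_mul_self_mul d d, Complex.ofReal_re] at h
  have hd : ∀ i, 0 < d.eigenvalue i := eigenvalue_ofIsHermitian_pos hX
  have h₀ : ∀ j i, 0 ≤ d.eigenvalue i * ‖coord d d W j i‖ ^ 2 := fun j i =>
    mul_nonneg (hd i).le (sq_nonneg _)
  rw [← coord_eq_zero_iff d d]
  ext j i
  have h₁ := (Finset.sum_eq_zero_iff_of_nonneg fun j _ => Finset.sum_nonneg fun i _ => h₀ j i).mp
    (le_antisymm h (Finset.sum_nonneg fun j _ => Finset.sum_nonneg fun i _ => h₀ j i))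
    j (Finset.mem_univ j)
  have h₂ := (Finset.sum_eq_zero_iff_of_nonneg fun i _ => h₀ j i).mp h₁ i (Finset.mem_univ i)
  simpa [(hd i).ne'] using h₂

/-- Test the trace estimate on the eigenprojection `Z = uᵢ uᵢ*`. -/
theorem eigenvalue_hsAdjoint_nonneg {X : Mat m} (hΦ : IsCompletelyPositive Φ) (h₁ : IsUnital Φ)
    (hX : X.PosSemidef) (d : Diagonalization (hsAdjoint Φ X)) (i : Fin n) :
    0 ≤ d.eigenvalue i := by
  rw [← trace_transition_source d d i i]
  refine le_trans ?_ (hΦ.trace_conjTranspose_mul_le h₁ hX _)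
  exact (Complex.le_def.mp ((posSemidef_conjTranspose_mul_self _).trace_mul_nonneg hX)).1

/-- For `Z = vⱼ uᵢ*` the coordinate is `⟨Z, Φ† K⟩ = ⟨Φ Z, K⟩`. A nonpositive eigenvalue at `i` or
`j` would force `Φ Z = 0` by the trace estimates and definiteness of `X` or `Y`. -/
theorem supports_hsAdjoint {X Y : Mat m} (hΦ : IsCompletelyPositive Φ) (h₁ : IsUnital Φ)
    (hX : X.PosDef) (hY : Y.PosDef) (dX : Diagonalization (hsAdjoint Φ X))
    (dY : Diagonalization (hsAdjoint Φ Y)) (K : Mat m) : Supports dX dY (hsAdjoint Φ K) := by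
  intro j i hk
  have hZ : Φ (transition dX dY j i) ≠ 0 := by
    intro h
    rw [← trace_conjTranspose_transition_mul, trace_hsAdjoint, h] at hk
    simp at hk
  constructor
  · by_contra! h
    refine hZ (eq_zero_of_trace_mul_nonpos hX ?_)
    refine (hΦ.trace_conjTranspose_mul_le h₁ hX.posSemidef _).trans ?_
    rwa [trace_transition_source]
  · by_contra! h
    refine hZ (conjTranspose_eq_zero.mp (eq_zero_of_trace_mul_nonpos hY ?_))
    rw [conjTranspose_conjTranspose]
    refine (hΦ.trace_mul_conjTranspose_le h₁ hY.posSemidef _).trans ?_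
    rwa [trace_transition_target]

theorem resolventForm_hsAdjoint_le {X Y : Mat m} (hΦ : IsCompletelyPositive Φ) (h₁ : IsUnital Φ)
    (hX : X.PosSemidef) (hY : Y.PosSemidef) (dX : Diagonalization X) (dY : Diagonalization Y)
    (hdX : ∀ i, 0 < dX.eigenvalue i) (hdY : ∀ j, 0 < dY.eigenvalue j)
    (dX' : Diagonalization (hsAdjoint Φ X)) (dY' : Diagonalization (hsAdjoint Φ Y)) (K : Mat m)
    {t : ℝ} (ht : 0 ≤ t) :
    resolventForm dX' dY' (hsAdjoint Φ K) t ≤ resolventForm dX dY K t := by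
  obtain ⟨Z, hZ⟩ := exists_dualFunctional_eq dX' dY' (hsAdjoint Φ K) t
  rw [← hZ]
  exact (hΦ.dualFunctional_le_dualFunctional h₁ hX hY K Z ht).trans
    (dualFunctional_le dX dY K _ fun i j =>
      add_pos_of_nonneg_of_pos (mul_nonneg ht (hdX i).le) (hdY j))

end Diagonalization

/-- The integral form contracts under `Φ†`. -/
theorem traceIntegral_hsAdjoint_le {X Y : Mat m} (hX : X.PosDef) (hY : Y.PosDef)
    {Φ : Mat n →ₗ[ℂ] Mat m} (hΦ : IsCompletelyPositive Φ) (h₁ : IsUnital Φ) (K : Mat m) :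
    IntegrableOn (integrand X Y Kᴴ K) (Ioi 0) ∧
      IntegrableOn (integrand (hsAdjoint Φ X) (hsAdjoint Φ Y) (hsAdjoint Φ Kᴴ) (hsAdjoint Φ K))
        (Ioi 0) ∧
      0 ≤ traceIntegral (hsAdjoint Φ X) (hsAdjoint Φ Y) (hsAdjoint Φ Kᴴ) (hsAdjoint Φ K) ∧
      traceIntegral (hsAdjoint Φ X) (hsAdjoint Φ Y) (hsAdjoint Φ Kᴴ) (hsAdjoint Φ K) ≤
        traceIntegral X Y Kᴴ K := by
  have hX' : (hsAdjoint Φ X).IsHermitian := by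
    rw [IsHermitian, ← hΦ.hsAdjoint_conjTranspose, hX.isHermitian.eq]
  have hY' : (hsAdjoint Φ Y).IsHermitian := by
    rw [IsHermitian, ← hΦ.hsAdjoint_conjTranspose, hY.isHermitian.eq]
  rw [hΦ.hsAdjoint_conjTranspose]
  set dX := ofIsHermitian hX.isHermitian
  set dY := ofIsHermitian hY.isHermitian
  have hdX : ∀ i, 0 < dX.eigenvalue i := eigenvalue_ofIsHermitian_pos hX
  have hdY : ∀ i, 0 < dY.eigenvalue i := eigenvalue_ofIsHermitian_pos hY
  have hdX' := eigenvalue_hsAdjoint_nonneg hΦ h₁ hX.posSemidef (ofIsHermitian hX')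
  have hdY' := eigenvalue_hsAdjoint_nonneg hΦ h₁ hY.posSemidef (ofIsHermitian hY')
  have hK := supports_of_pos hdX hdY K
  have hK' := supports_hsAdjoint hΦ h₁ hX hY (ofIsHermitian hX') (ofIsHermitian hY') K
  refine ⟨integrableOn_integrand (fun i => (hdX i).le) (fun j => (hdY j).le) hK _,
    integrableOn_integrand hdX' hdY' hK' _, ?_, ?_⟩
  · rw [traceIntegral_eq_integral_resolventForm hdX' hdY' hK', Complex.zero_le_real]
    refine setIntegral_nonneg measurableSet_Ioi fun t (ht : 0 < t) => mul_nonneg (by positivity) ?_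
    exact Finset.sum_nonneg fun j _ => Finset.sum_nonneg fun i _ =>
      div_nonneg (sq_nonneg _) (add_nonneg (mul_nonneg ht.le (hdX' i)) (hdY' j))
  · rw [traceIntegral_eq_integral_resolventForm hdX' hdY' hK',
      traceIntegral_eq_integral_resolventForm (fun i => (hdX i).le) (fun j => (hdY j).le) hK,
      Complex.real_le_real]
    refine setIntegral_mono_on (integrableOn_resolventForm hK') (integrableOn_resolventForm hK)
      measurableSet_Ioi fun t (ht : 0 < t) => ?_
    exact mul_le_mul_of_nonneg_left (resolventForm_hsAdjoint_le hΦ h₁ hX.posSemidef hY.posSemidef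
      dX dY hdX hdY _ _ K ht.le) (by positivity)

/-! ### Smooth dependence on the state. -/

/-- The segment from `1` to `ρ`, as an affine function of `ρ` with values in the Banach algebra of
continuous functions on the unit interval. -/
def segment (ρ : Mat n) : C(unitInterval, Mat n) where
  toFun t := (1 - t : ℝ) • 1 + (t : ℝ) • ρ
  continuous_toFun := by fun_prop

theorem contDiff_segment : ContDiff ℝ ∞ (segment : Mat n → C(unitInterval, Mat n)) := by
  let l : Mat n →ₗ[ℝ] C(unitInterval, Mat n) :=
    { toFun := fun ρ => segment ρ - segment 0
      map_add' := fun A B => by ext; simp [segment]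
      map_smul' := fun a A => by ext; simp [segment]; ring }
  have h : (segment : Mat n → C(unitInterval, Mat n)) =
      fun ρ => l.toContinuousLinearMap ρ + segment 0 := by
    ext ρ
    simp [l]
  rw [h]
  exact l.toContinuousLinearMap.contDiff.add contDiff_const

theorem isUnit_segment {ρ : Mat n} (h : ρ.PosDef) : IsUnit (segment ρ) := by
  rw [ContinuousMap.isUnit_iff_forall_isUnit]
  intro t
  refine PosDef.isUnit ?_
  change ((1 - t : ℝ) • (1 : Mat n) + (t : ℝ) • ρ).PosDef
  rcases t.2.1.eq_or_lt with h₀ | h₀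
  · rw [← h₀]
    simpa using PosDef.one
  · exact PosDef.posSemidef_add (PosSemidef.one.smul (sub_nonneg.mpr t.2.2)) (h.smul h₀)

/-- The weight `(1 + s)⁻²`. -/
def weight (s : ℝ) : ℝ := ((s + 1) * (s + 1))⁻¹

theorem weight_nonneg (s : ℝ) : 0 ≤ weight s := inv_nonneg.mpr (mul_self_nonneg _)

theorem integrableOn_weight : IntegrableOn weight (Ioi 0) :=
  integrableOn_inv_mul_add one_pos one_pos

/-- The change of variables `s ↦ (1 + s)⁻¹`, extended to the line. -/
def toUnitInterval (s : ℝ) : unitInterval :=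
  ⟨(1 + |s|)⁻¹, by positivity, inv_le_one_of_one_le₀ (by linarith [abs_nonneg s])⟩

theorem continuous_toUnitInterval : Continuous toUnitInterval :=
  Continuous.subtype_mk (Continuous.inv₀ (by fun_prop) fun s => by positivity) _

theorem norm_weight_smul_le (f : C(unitInterval, Mat n)) (s : ℝ) :
    ‖weight s • f (toUnitInterval s)‖ ≤ weight s * ‖f‖ := by
  rw [norm_smul, Real.norm_of_nonneg (weight_nonneg s)]
  exact mul_le_mul_of_nonneg_left (f.norm_coe_le_norm _) (weight_nonneg s)

theorem integrableOn_weight_smul (f : C(unitInterval, Mat n)) :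
    IntegrableOn (fun s => weight s • f (toUnitInterval s)) (Ioi 0) :=
  (integrableOn_weight.mul_const ‖f‖).mono'
    (integrableOn_weight.aestronglyMeasurable.smul
      (f.continuous.comp continuous_toUnitInterval).aestronglyMeasurable)
    (.of_forall (norm_weight_smul_le f))

/-- Integration over the half-line, transported to the unit interval. -/
def weightedIntegral (n : ℕ) : C(unitInterval, Mat n) →L[ℝ] Mat n :=
  LinearMap.mkContinuous
    { toFun := fun f => ∫ s in Ioi (0 : ℝ), weight s • f (toUnitInterval s)
      map_add' := fun f g => by
        rw [← integral_add (integrableOn_weight_smul f) (integrableOn_weight_smul g)]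
        simp
      map_smul' := fun a f => by
        rw [RingHom.id_apply, ← integral_smul]
        simp only [ContinuousMap.smul_apply, smul_comm a] }
    (∫ s in Ioi (0 : ℝ), weight s) fun f => by
      rw [← integral_mul_const]
      exact norm_integral_le_of_norm_le (integrableOn_weight.mul_const ‖f‖)
        (.of_forall (norm_weight_smul_le f))

/-- A smooth extension of `traceIntegral ρ ρ K L` from positive definite `ρ`. -/
def traceExtension (K L ρ : Mat n) : ℂ :=
  (weightedIntegral n (ContinuousMap.const _ K * Ring.inverse (segment ρ) *
    ContinuousMap.const _ L * Ring.inverse (segment ρ))).trace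

/-- Each resolvent yields one factor `(1 + s)⁻¹`; the two together make up `weight`. -/
theorem inv_smul_one_add_eq {ρ : Mat n} (h : ρ.PosDef) {s : ℝ} (hs : 0 < s) :
    ((s : ℂ) • (1 : Mat n) + ρ)⁻¹ =
      (1 + s)⁻¹ • Ring.inverse (segment ρ) (toUnitInterval s) := by
  have h₁ := DFunLike.congr_fun (Ring.mul_inverse_cancel _ (isUnit_segment h)) (toUnitInterval s)
  refine inv_eq_right_inv ?_
  have h₂ : segment ρ (toUnitInterval s) = (1 + s)⁻¹ • ((s : ℂ) • (1 : Mat n) + ρ) := by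
    simp only [segment, toUnitInterval, ContinuousMap.coe_mk, abs_of_pos hs, smul_add]
    congr 1
    rw [Complex.coe_smul, smul_smul]
    congr 1
    field_simp
    ring
  rw [mul_smul_comm, ← smul_mul_assoc, ← h₂]
  exact h₁

theorem traceExtension_eq {ρ : Mat n} (h : ρ.PosDef) (K L : Mat n) :
    traceExtension K L ρ = traceIntegral ρ ρ K L := by
  rw [traceExtension, traceIntegral]
  congr 1
  refine setIntegral_congr_fun measurableSet_Ioi fun s (hs : 0 < s) => ?_
  simp only [integrand, inv_smul_one_add_eq h hs, ContinuousMap.mul_apply,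
    ContinuousMap.const_apply, mul_smul_comm, smul_mul_assoc, smul_smul, weight]
  rw [mul_inv, add_comm]

theorem contDiffAt_traceExtension {ρ : Mat n} (h : ρ.PosDef) (K L : Mat n) :
    ContDiffAt ℝ ∞ (traceExtension K L) ρ := by
  have h₁ : ContDiffAt ℝ ∞ (fun ρ : Mat n => Ring.inverse (segment ρ)) ρ := by
    obtain ⟨u, hu⟩ := isUnit_segment h
    have h₂ : ContDiffAt ℝ ∞ Ring.inverse (segment ρ) := hu ▸ contDiffAt_ringInverse ℝ u
    exact h₂.comp ρ contDiff_segment.contDiffAt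
  have h₂ : ContDiff ℝ ∞ (fun f : C(unitInterval, Mat n) => (weightedIntegral n f).trace) :=
    (traceLinearMap (Fin n) ℝ ℂ).toContinuousLinearMap.contDiff.comp (weightedIntegral n).contDiff
  exact h₂.contDiffAt.comp ρ (((contDiffAt_const.mul h₁).mul contDiffAt_const).mul h₁)

/-! ### Riemannian properties and contraction of the metric. -/

/-- The Bogoliubov-Kubo-Mori metric in an eigenbasis of `ρ`. -/
theorem bkmMetric_eq {ρ : Mat n} (h : ρ.PosDef) (K L : Mat n) :
    bkmMetric n ρ K L = ∑ j, ∑ i,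
      resolventIntegral (h.isHermitian.eigenvalues i) (h.isHermitian.eigenvalues j) *
        (coord (ofIsHermitian h.isHermitian) (ofIsHermitian h.isHermitian) K i j *
          coord (ofIsHermitian h.isHermitian) (ofIsHermitian h.isHermitian) L j i).re := by
  have hd := eigenvalue_ofIsHermitian_pos h
  rw [bkmMetric, traceIntegral_eq (fun i => (hd i).le) (fun j => (hd j).le)
    (supports_of_pos hd hd L) K]
  simp only [Complex.re_sum, Complex.re_ofReal_mul]
  rfl

theorem bkmMetric_add_left {ρ : Mat n} (h : ρ.PosDef) (K K' L : Mat n) :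
    bkmMetric n ρ (K + K') L = bkmMetric n ρ K L + bkmMetric n ρ K' L := by
  simp only [bkmMetric_eq h, coord_add, ← Finset.sum_add_distrib]
  refine Finset.sum_congr rfl fun j _ => Finset.sum_congr rfl fun i _ => ?_
  rw [Matrix.add_apply, add_mul, Complex.add_re, mul_add]

theorem bkmMetric_smul_left {ρ : Mat n} (h : ρ.PosDef) (a : ℝ) (K L : Mat n) :
    bkmMetric n ρ (a • K) L = a * bkmMetric n ρ K L := by
  simp only [bkmMetric_eq h, coord_smul, Finset.mul_sum]
  refine Finset.sum_congr rfl fun j _ => Finset.sum_congr rfl fun i _ => ?_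
  rw [Matrix.smul_apply, Complex.real_smul, mul_assoc, Complex.re_ofReal_mul, mul_left_comm]

theorem bkmMetric_comm {ρ : Mat n} (h : ρ.PosDef) (K L : Mat n) :
    bkmMetric n ρ K L = bkmMetric n ρ L K := by
  rw [bkmMetric_eq h, bkmMetric_eq h, Finset.sum_comm]
  refine Finset.sum_congr rfl fun j _ => Finset.sum_congr rfl fun i _ => ?_
  rw [resolventIntegral_comm, mul_comm (coord _ _ K _ _)]

theorem bkmMetric_pos {ρ : Mat n} (h : ρ.PosDef) {K : Mat n} (hK : K.IsHermitian)
    (h₀ : K ≠ 0) : 0 < bkmMetric n ρ K K := by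
  set d := ofIsHermitian h.isHermitian with hd_def
  have hd : ∀ i, 0 < d.eigenvalue i := eigenvalue_ofIsHermitian_pos h
  have h₁ := traceIntegral_conjTranspose_eq (fun i => (hd i).le) (fun j => (hd j).le)
    (supports_of_pos hd hd K)
  rw [hK.eq] at h₁
  rw [bkmMetric, h₁, Complex.ofReal_re]
  have h₂ : ∀ j i, 0 ≤ resolventIntegral (d.eigenvalue i) (d.eigenvalue j) *
      ‖coord d d K j i‖ ^ 2 := fun j i =>
    mul_nonneg (resolventIntegral_pos (hd i) (hd j)).le (sq_nonneg _)
  obtain ⟨j, i, hji⟩ : ∃ j i, coord d d K j i ≠ 0 := by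
    by_contra! h'
    exact h₀ ((coord_eq_zero_iff d d).mp (by ext j i; exact h' j i))
  refine Finset.sum_pos' (fun j _ => Finset.sum_nonneg fun i _ => h₂ j i)
    ⟨j, Finset.mem_univ j, Finset.sum_pos' (fun i _ => h₂ j i) ⟨i, Finset.mem_univ i, ?_⟩⟩
  exact mul_pos (resolventIntegral_pos (hd i) (hd j)) (pow_pos (norm_pos_iff.mpr hji) 2)

/-- `states n` lies in an affine slice, so smoothness is taken from an extension that is smooth on a
full neighbourhood. -/
theorem contDiffOn_bkmMetric (K L : Mat n) :
    ContDiffOn ℝ ∞ (fun ρ => bkmMetric n ρ K L) (states n) := by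
  intro ρ hρ
  have h : ContDiffAt ℝ ∞ (fun ρ => (traceExtension K L ρ).re) ρ :=
    Complex.reCLM.contDiff.contDiffAt.comp ρ (contDiffAt_traceExtension hρ.1 K L)
  refine h.contDiffWithinAt.congr (fun σ hσ => ?_) ?_
  · rw [bkmMetric, traceExtension_eq hσ.1]
  · rw [bkmMetric, traceExtension_eq hρ.1]

theorem bkmMetric_hsAdjoint_le (hΦ : IsCompletelyPositive Φ) (h₁ : IsUnital Φ) {ρ K : Mat m}
    (hρ : ρ.PosDef) (hK : K.IsHermitian) :
    bkmMetric n (hsAdjoint Φ ρ) (hsAdjoint Φ K) (hsAdjoint Φ K) ≤ bkmMetric m ρ K K := by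
  have h := (traceIntegral_hsAdjoint_le hρ hρ hΦ h₁ K).2.2.2
  rw [hK.eq] at h
  exact (Complex.le_def.mp h).1

/-! ### Geodesic distance. -/

theorem derivWithin_mem_tangent {c : ℝ → Mat n} {s : Set ℝ} {t : ℝ}
    (hc : DifferentiableWithinAt ℝ c s t) (hs : UniqueDiffWithinAt ℝ s t)
    (hm : MapsTo c s (states n)) (ht : t ∈ s) : derivWithin c s t ∈ tangent n := by
  have hd := hc.hasDerivWithinAt
  -- A linear map constant on states kills velocities; it is applied to `A ↦ A* - A` and to the
  -- trace.
  have h_map (E : Type) [NormedAddCommGroup E] [NormedSpace ℝ E] (l : Mat n →ₗ[ℝ] E) (e : E)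
      (he : ∀ ρ ∈ states n, l ρ = e) : l (derivWithin c s t) = 0 := by
    have h₁ : HasDerivWithinAt (fun u => l (c u)) (l (derivWithin c s t)) s t :=
      l.toContinuousLinearMap.hasFDerivAt.comp_hasDerivWithinAt t hd
    have h₂ : HasDerivWithinAt (fun u => l (c u)) 0 s t :=
      (hasDerivWithinAt_const t s e).congr (fun u hu => he _ (hm hu)) (he _ (hm ht))
    exact hs.eq_deriv _ h₁ h₂
  constructor
  · have := h_map (Mat n)
      ((conjTransposeLinearEquiv (Fin n) (Fin n) ℝ ℂ).toLinearMap - LinearMap.id) 0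
      fun ρ hρ => sub_eq_zero.mpr hρ.1.isHermitian.eq
    exact sub_eq_zero.mp this
  · exact h_map ℂ (traceLinearMap (Fin n) ℝ ℂ) 1 fun ρ hρ => hρ.2

theorem geodesicDist_hsAdjoint_le (hΦ : IsCompletelyPositive Φ) (h₁ : IsUnital Φ)
    (hm : MapsTo (hsAdjoint Φ) (states m) (states n)) (ρ₁ ρ₂ : Mat m) :
    geodesicDist (bkmMetric n) (hsAdjoint Φ ρ₁) (hsAdjoint Φ ρ₂) ≤
      geodesicDist (bkmMetric m) ρ₁ ρ₂ := by
  let l : Mat m →L[ℝ] Mat n := ((hsAdjoint Φ).restrictScalars ℝ).toContinuousLinearMap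
  refine le_iInf₂ fun c ⟨hc, hcs, hc₀, hc₁⟩ => ?_
  refine (iInf₂_le (fun t => l (c t)) ⟨l.contDiff.comp_contDiffOn hc, fun t ht => hm (hcs ht),
    congrArg l hc₀, congrArg l hc₁⟩).trans ?_
  -- Lengths are compared through speeds at each time.
  refine setLIntegral_mono' measurableSet_Icc fun t ht => ENNReal.ofReal_le_ofReal
    (Real.sqrt_le_sqrt ?_)
  have hu := uniqueDiffOn_Icc (zero_lt_one' ℝ) t ht
  have hd := hc.differentiableOn one_ne_zero t ht
  have h₂ : derivWithin (fun t => l (c t)) (Icc 0 1) t = hsAdjoint Φ (derivWithin c (Icc 0 1) t) :=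
    (l.hasFDerivAt.comp_hasDerivWithinAt t hd.hasDerivWithinAt).derivWithin hu
  rw [h₂]
  exact bkmMetric_hsAdjoint_le hΦ h₁ (hcs ht).1 (derivWithin_mem_tangent hd hu hcs ht).1

theorem isMonotoneMetric_bkmMetric : IsMonotoneMetric bkmMetric where
  add_left _ _ hρ K _ K' _ L _ := bkmMetric_add_left hρ.1 K K' L
  smul_left _ _ hρ a K _ L _ := bkmMetric_smul_left hρ.1 a K L
  symm _ _ hρ K _ L _ := bkmMetric_comm hρ.1 K L
  pos _ _ hρ _ hK h₀ := bkmMetric_pos hρ.1 hK.1 h₀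
  smooth _ K _ L _ := contDiffOn_bkmMetric K L
  contract _ _ _ hΦ h₁ _ _ hρ _ hK := bkmMetric_hsAdjoint_le hΦ h₁ hρ.1 hK.1
  dist_contract _ _ _ hΦ h₁ hm ρ₁ _ ρ₂ _ := geodesicDist_hsAdjoint_le hΦ h₁ hm ρ₁ ρ₂

end Lieb

end

theorem theorem2p7 :
    (∀ (m n : ℕ) (X Y K : Lieb.Mat m) (Φ : Lieb.Mat n →ₗ[ℂ] Lieb.Mat m),
      X.PosDef → Y.PosDef → Lieb.IsCompletelyPositive Φ → Lieb.IsUnital Φ →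
        MeasureTheory.IntegrableOn
          (Lieb.integrand X Y K.conjTranspose K) (Set.Ioi 0) ∧
        MeasureTheory.IntegrableOn
          (Lieb.integrand (Lieb.hsAdjoint Φ X) (Lieb.hsAdjoint Φ Y)
            (Lieb.hsAdjoint Φ K.conjTranspose) (Lieb.hsAdjoint Φ K)) (Set.Ioi 0) ∧
        0 ≤ Lieb.traceIntegral (Lieb.hsAdjoint Φ X) (Lieb.hsAdjoint Φ Y)
            (Lieb.hsAdjoint Φ K.conjTranspose) (Lieb.hsAdjoint Φ K) ∧
        Lieb.traceIntegral (Lieb.hsAdjoint Φ X) (Lieb.hsAdjoint Φ Y)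
            (Lieb.hsAdjoint Φ K.conjTranspose) (Lieb.hsAdjoint Φ K) ≤
          Lieb.traceIntegral X Y K.conjTranspose K) ∧
    Lieb.IsMonotoneMetric Lieb.bkmMetric :=
  ⟨fun _ _ _ _ K _ hX hY hΦ h₁ => Lieb.traceIntegral_hsAdjoint_le hX hY hΦ h₁ K,
    Lieb.isMonotoneMetric_bkmMetric⟩
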